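/- Let $0<p<1$ and $p<q<\infty$, and let $(\mathbf{B},\|\cdot\|)$ be an arbitrary real separable Banach space with its Borel $\sigma$-algebra. Let $\{X_n;\ n\ge 1\}$ be a sequence of independent copies of a $\mathbf{B}$-valued random variable $X$ defined on a probability space $(\Omega,\mathcal{F},\mathbb{P})$, and let $S_n=X_1+\cdots+X_n$ for $n\ge 1$. We say that $X$ satisfies the $(p,q)$-type strong law of large numbers, and write $X\in SLLN(p,q)$, if $$\sum_{n=1}^{\infty}\frac{1}{n}\left(\frac{\|S_n\|}{n^{1/p}}\right)^{q}<\infty\quad\text{almost surely.}$$ Then the following two statements hold: (a) $X\in SLLN(p,q)$ if and only if $\mathbb{E}\|X\|^{p}<\infty$; (b) $\displaystyle\sum_{n=1}^{\infty}\frac{1}{n}\,\mathbb{E}\left(\frac{\|S_n\|}{n^{1/p}}\right)^{q}<\infty$ if and only if $\mathbb{E}\|X\|^{q}<\infty$. -/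

import Mathlib

open MeasureTheory ProbabilityTheory
open scoped ENNReal

namespace PQStrongLaw

variable {Ω B : Type*} [MeasurableSpace Ω] [NormedAddCommGroup B]

/-- `Xs 0, Xs 1, …` (playing the roles of `X₁, X₂, …`) is a sequence of independent copies of
the random variable `X`: the `Xs n` are independent, and each has the distribution of `X`.
(`IdentDistrib` includes the a.e.-measurability of both random variables.) -/
structure IsIndepCopies [MeasurableSpace B] (μ : Measure Ω) (X : Ω → B) (Xs : ℕ → Ω → B) :
    Prop where
  indep : iIndepFun Xs μ
  identDistrib : ∀ n, IdentDistrib (Xs n) X μ μ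

/-- The partial sum `S_n = X_1 + ⋯ + X_n` of the first `n` variables. -/
def partialSum (Xs : ℕ → Ω → B) (n : ℕ) (ω : Ω) : B :=
  ∑ k ∈ Finset.range n, Xs k ω

/-- The random variable `(‖S_n‖ / n^{1/p})^q`, as an extended nonnegative real; used only for
`n ≥ 1`, where it is the (finite) real number of that name. -/
noncomputable def normalizedPow (p q : ℝ) (Xs : ℕ → Ω → B) (n : ℕ) (ω : Ω) : ℝ≥0∞ :=
  (‖partialSum Xs n ω‖ₑ / (n : ℝ≥0∞) ^ (1 / p)) ^ q

/-- The `(p, q)`-type strong law of large numbers: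
`∑_{n ≥ 1} (1/n) (‖S_n‖ / n^{1/p})^q < ∞` almost surely (the summation index is shifted by
one, so that the sum starts with the term of `S_1`). -/
def SLLN (μ : Measure Ω) (p q : ℝ) (Xs : ℕ → Ω → B) : Prop :=
  ∀ᵐ ω ∂μ, ∑' n : ℕ, ((n + 1 : ℕ) : ℝ≥0∞)⁻¹ * normalizedPow p q Xs (n + 1) ω < ∞

end PQStrongLaw

/-! Since `p < 1`, sufficiency in (a) needs only the triangle inequality, not the geometry of `B`.
For `q ≤ 1`, subadditivity of `t ^ q` and an interchange of sums bound the series by a multiple of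
`∑ (‖X_k‖ / k^{1/p})^q`, finite a.s. because truncating its terms at 1 leaves expectation
`O(E‖X‖^p)` (`tsum_min_one_le`). For `q ≥ 1`, convergence of `∑ ‖X_k‖ / k^{1/p}` bounds `‖S_n‖ /
n^{1/p}` uniformly and reduces to `q = 1` (`weightedSum_le_of_one_le`). Statement (b) rests on
`E‖S_n‖^q ≤ n^{max(q,1)} E‖X‖^q`.

Necessity in (a) goes through the differences `D_n` of disjoint pairs of variables. Swapping the
coordinates in every pair but the `j`-th preserves the product law and negates every `D_n` except
`D_j`; adding the two sequences isolates `D_j`. The Lévy-type inequality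
`measure_exists_lt_le_two_mul` then gives, with positive probability, `‖D_n‖ ≤ K (n+1)^{1/p}` for
all `n`. By the second Borel–Cantelli lemma, `∑ P(‖X‖ > L (n+1)^{1/p})` converges for some finite
`L`, so `E‖X‖^p < ∞`. -/

namespace PQStrongLaw

/-! ### Tails of power series and elementary inequalities in `ℝ≥0∞`. -/

lemma mul_succ_rpow_le_sub {a : ℝ} (ha : 0 < a) {k : ℝ} (hk : 0 < k) :
    a * (k + 1) ^ (-(1 + a)) ≤ k ^ (-a) - (k + 1) ^ (-a) := by
  have hk1 : 0 < k + 1 := by linarith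
  have hlog : 1 / (k + 1) ≤ Real.log ((k + 1) / k) := by
    have h := Real.one_sub_inv_le_log_of_pos (div_pos hk1 hk)
    have : 1 - ((k + 1) / k)⁻¹ = 1 / (k + 1) := by field_simp; ring
    linarith
  have hexp : 1 + a / (k + 1) ≤ ((k + 1) / k) ^ a := by
    rw [Real.rpow_def_of_pos (div_pos hk1 hk)]
    have h := Real.add_one_le_exp (Real.log ((k + 1) / k) * a)
    have h2 := mul_le_mul_of_nonneg_right hlog ha.le
    have h3 : a / (k + 1) = 1 / (k + 1) * a := by ring
    linarith
  have hsplit : k ^ (-a) = (k + 1) ^ (-a) * ((k + 1) / k) ^ a := by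
    rw [Real.div_rpow hk1.le hk.le, Real.rpow_neg hk.le, Real.rpow_neg hk1.le]
    have := (Real.rpow_pos_of_pos hk1 a).ne'
    field_simp
  have hsplit2 : (k + 1) ^ (-(1 + a)) = (k + 1) ^ (-a) * (k + 1)⁻¹ := by
    rw [← Real.rpow_neg_one (k + 1), ← Real.rpow_add hk1]; ring_nf
  have h := mul_le_mul_of_nonneg_left hexp (Real.rpow_nonneg hk1.le (-a))
  rw [hsplit, hsplit2]
  have : (k + 1) ^ (-a) * (1 + a / (k + 1)) =
      (k + 1) ^ (-a) + a * ((k + 1) ^ (-a) * (k + 1)⁻¹) := by ring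
  linarith

lemma sum_succ_rpow_le {a : ℝ} (ha : 0 < a) {k : ℝ} (hk : 0 < k) (N : ℕ) :
    ∑ n ∈ Finset.range N, (k + n + 1) ^ (-(1 + a)) ≤ a⁻¹ * (k ^ (-a) - (k + N) ^ (-a)) := by
  induction N with
  | zero => simp
  | succ N ih =>
    rw [Finset.sum_range_succ]
    have h := mul_succ_rpow_le_sub ha (k := k + N) (by positivity)
    have h2 : (k + N + 1) ^ (-(1 + a)) ≤ a⁻¹ * ((k + N) ^ (-a) - (k + N + 1) ^ (-a)) := by
      rw [← div_eq_inv_mul, le_div_iff₀ ha]; linarith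
    push_cast
    rw [← add_assoc]
    nlinarith

lemma natCast_succ_rpow (n : ℕ) (s : ℝ) :
    ((n : ℝ≥0∞) + 1) ^ s = ENNReal.ofReal (((n : ℝ) + 1) ^ s) := by
  rw [← ENNReal.ofReal_rpow_of_pos (by positivity),
    ENNReal.ofReal_add (by positivity) zero_le_one]
  simp

lemma tsum_tail_rpow_le {a : ℝ} (ha : 0 < a) (k : ℕ) :
    ∑' n : ℕ, ((n + k : ℕ) + 1 : ℝ≥0∞) ^ (-(1 + a)) ≤
      ENNReal.ofReal (1 + a⁻¹) * ((k : ℝ≥0∞) + 1) ^ (-a) := by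
  refine ENNReal.tsum_le_of_sum_range_le fun N ↦ ?_
  simp_rw [natCast_succ_rpow]
  rw [← ENNReal.ofReal_mul (by positivity), ← ENNReal.ofReal_sum_of_nonneg
    (fun _ _ ↦ by positivity)]
  refine ENNReal.ofReal_le_ofReal ?_
  have hk : (0 : ℝ) < k + 1 := by positivity
  calc ∑ n ∈ Finset.range N, (((n + k : ℕ) : ℝ) + 1) ^ (-(1 + a))
      -- The extra term makes exactly `N` telescoping terms remain once index 0 is split off; that
      -- index accounts for the `1` in `1 + a⁻¹`.
      ≤ ∑ n ∈ Finset.range (N + 1), (((n + k : ℕ) : ℝ) + 1) ^ (-(1 + a)) :=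
        Finset.sum_le_sum_of_subset_of_nonneg (by simp) fun _ _ _ ↦ by positivity
    _ = (∑ n ∈ Finset.range N, ((k : ℝ) + 1 + n + 1) ^ (-(1 + a))) +
          ((k : ℝ) + 1) ^ (-(1 + a)) := by
        rw [Finset.sum_range_succ']
        push_cast
        congr 1
        · exact Finset.sum_congr rfl fun n _ ↦ by ring_nf
        · ring_nf
    _ ≤ a⁻¹ * ((k : ℝ) + 1) ^ (-a) + ((k : ℝ) + 1) ^ (-a) := by
        gcongr ?_ + ?_
        · refine (sum_succ_rpow_le ha hk N).trans ?_
          gcongr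
          have : 0 ≤ ((k : ℝ) + 1 + N) ^ (-a) := by positivity
          linarith
        · exact Real.rpow_le_rpow_of_exponent_le (by linarith [(Nat.cast_nonneg k : (0:ℝ) ≤ k)])
            (by linarith)
    _ = (1 + a⁻¹) * ((k : ℝ) + 1) ^ (-a) := by ring

lemma tsum_rpow_lt_top {s : ℝ} (hs : s < -1) : ∑' n : ℕ, ((n : ℝ≥0∞) + 1) ^ s < ∞ := by
  have h := tsum_tail_rpow_le (a := -s - 1) (by linarith) 0
  have e : -(1 + (-s - 1)) = s := by ring
  rw [e] at h
  simp only [add_zero, Nat.cast_zero, zero_add, ENNReal.one_rpow, mul_one] at h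
  exact h.trans_lt ENNReal.ofReal_lt_top

lemma succ_ne_zero' (n : ℕ) : (n : ℝ≥0∞) + 1 ≠ 0 := by simp
lemma succ_ne_top (n : ℕ) : (n : ℝ≥0∞) + 1 ≠ ∞ := by simp

/-- The tail sums `∑_{n ≥ k} (n+1)^{-(1+a)}` are at least of order `(k+1)^{-a}`. -/
lemma le_tsum_tail_rpow {a : ℝ} (ha : 0 < a) (k : ℕ) :
    (2 : ℝ≥0∞) ^ (-(1 + a)) * ((k : ℝ≥0∞) + 1) ^ (-a) ≤
      ∑' n : ℕ, ((n + k : ℕ) + 1 : ℝ≥0∞) ^ (-(1 + a)) := by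
  refine le_trans ?_ (ENNReal.sum_le_tsum (Finset.range (k + 1)))
  -- The `k + 1` terms with `n ≤ k` already have the right total order.
  have : ∀ n ∈ Finset.range (k + 1), ((2 : ℝ≥0∞) * (k + 1)) ^ (-(1 + a)) ≤
      ((n + k : ℕ) + 1 : ℝ≥0∞) ^ (-(1 + a)) := by
    intro n hn
    rw [ENNReal.rpow_neg, ENNReal.rpow_neg]
    refine ENNReal.inv_le_inv.2 (ENNReal.rpow_le_rpow ?_ (by linarith))
    rw [Finset.mem_range] at hn
    exact_mod_cast (by omega : n + k + 1 ≤ 2 * (k + 1))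
  refine le_trans (le_of_eq ?_) (Finset.sum_le_sum this)
  rw [Finset.sum_const, Finset.card_range, nsmul_eq_mul,
    ENNReal.mul_rpow_of_ne_top (by simp) (succ_ne_top k), mul_left_comm]
  congr 1
  have : -a = 1 + -(1 + a) := by ring
  rw [this, ENNReal.rpow_add _ _ (succ_ne_zero' k) (succ_ne_top k)]
  simp

/-- Interchange of the sums over `k ≤ n`. -/
lemma tsum_mul_sum_range_succ (w f : ℕ → ℝ≥0∞) :
    ∑' n, w n * ∑ k ∈ Finset.range (n + 1), f k = ∑' k, f k * ∑' n, w (n + k) := by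
  have h1 : ∀ n, w n * ∑ k ∈ Finset.range (n + 1), f k =
      ∑' k, if k ≤ n then w n * f k else 0 := by
    intro n
    rw [tsum_eq_sum (s := Finset.range (n + 1)), Finset.mul_sum]
    · refine Finset.sum_congr rfl fun k hk ↦ ?_
      rw [if_pos (by simpa [Nat.lt_succ_iff] using hk)]
    · intro k hk
      rw [if_neg (by simpa [Nat.lt_succ_iff] using hk)]
  simp_rw [h1]
  rw [ENNReal.tsum_comm]
  refine tsum_congr fun k ↦ ?_
  rw [← ENNReal.summable.sum_add_tsum_nat_add' (k := k), Finset.sum_eq_zero, zero_add,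
    ← ENNReal.tsum_mul_left]
  · refine tsum_congr fun n ↦ ?_
    rw [if_pos (Nat.le_add_left k n), mul_comm]
  · intro n hn
    rw [if_neg (by simpa using hn)]

lemma rpow_sum_le_sum_rpow {q : ℝ} (hq0 : 0 < q) (hq1 : q ≤ 1) (s : Finset ℕ) (f : ℕ → ℝ≥0∞) :
    (∑ k ∈ s, f k) ^ q ≤ ∑ k ∈ s, f k ^ q := by
  classical
  induction s using Finset.induction_on with
  | empty => simp [hq0]
  | insert a s ha ih =>
    rw [Finset.sum_insert ha, Finset.sum_insert ha]
    exact (ENNReal.rpow_add_le_add_rpow _ _ hq0.le hq1).trans (by gcongr)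

lemma add_rpow_le {q : ℝ} (hq : 0 ≤ q) (a b : ℝ≥0∞) :
    (a + b) ^ q ≤ 2 ^ q * (a ^ q + b ^ q) := by
  wlog h : a ≤ b generalizing a b
  · rw [add_comm a b, add_comm (a ^ q)]
    exact this b a (le_of_not_ge h)
  calc (a + b) ^ q ≤ (2 * b) ^ q := by
        refine ENNReal.rpow_le_rpow ?_ hq
        rw [two_mul]; gcongr
    _ = 2 ^ q * b ^ q := ENNReal.mul_rpow_of_nonneg _ _ hq
    _ ≤ _ := by gcongr; exact le_add_self

/-- `∑_k min(1, (v / (k+1)^{1/p})^r) ≲ v^p` for `r > p`. -/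
lemma tsum_min_one_le {p r : ℝ} (hp : 0 < p) (hr : p < r) {v : ℝ≥0∞} (hv : v ≠ ∞) :
    ∑' k : ℕ, min 1 ((v / ((k : ℝ≥0∞) + 1) ^ (1 / p)) ^ r) ≤
      (1 + ENNReal.ofReal (1 + (r / p - 1)⁻¹)) * v ^ p := by
  have hr0 : 0 < r := hp.trans hr
  rcases eq_or_ne v 0 with rfl | hv0
  · simp [hr0, hp]
  have ha : 0 < r / p - 1 := by rw [sub_pos, one_lt_div hp]; exact hr
  have hvp : v ^ p ≠ ∞ := ENNReal.rpow_ne_top_of_nonneg hp.le hv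
  have hvp0 : v ^ p ≠ 0 := by simp [hv0, hv]
  -- The crossover index: the first `m` terms are bounded by 1, the others by the power tail.
  set m := ⌊(v ^ p).toReal⌋₊ with hm
  have hm1 : (m : ℝ≥0∞) ≤ v ^ p := by
    rw [← ENNReal.ofReal_toReal hvp, ← ENNReal.ofReal_natCast]
    exact ENNReal.ofReal_le_ofReal (Nat.floor_le ENNReal.toReal_nonneg)
  have hm2 : v ^ p ≤ (m : ℝ≥0∞) + 1 := by
    rw [← ENNReal.ofReal_toReal hvp, ← ENNReal.ofReal_natCast, ← ENNReal.ofReal_one,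
      ← ENNReal.ofReal_add (by positivity) zero_le_one]
    exact ENNReal.ofReal_le_ofReal (Nat.lt_floor_add_one _).le
  rw [← ENNReal.summable.sum_add_tsum_nat_add' (k := m), add_mul, one_mul]
  gcongr ?_ + ?_
  · refine le_trans (Finset.sum_le_sum fun _ _ ↦ min_le_left _ _) ?_
    simpa using hm1
  · have hterm : ∀ k : ℕ, (v / ((k : ℝ≥0∞) + 1) ^ (1 / p)) ^ r =
        v ^ r * ((k : ℝ≥0∞) + 1) ^ (-(1 + (r / p - 1))) := by
      intro k
      rw [ENNReal.div_rpow_of_nonneg _ _ hr0.le, ← ENNReal.rpow_mul, div_eq_mul_inv,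
        ← ENNReal.rpow_neg]
      congr 2; ring
    calc ∑' k : ℕ, min 1 ((v / (((k + m : ℕ) : ℝ≥0∞) + 1) ^ (1 / p)) ^ r)
        ≤ ∑' k : ℕ, v ^ r * (((k + m : ℕ) : ℝ≥0∞) + 1) ^ (-(1 + (r / p - 1))) :=
          ENNReal.tsum_le_tsum fun k ↦ (min_le_right _ _).trans (hterm _).le
      _ ≤ v ^ r * (ENNReal.ofReal (1 + (r / p - 1)⁻¹) * ((m : ℝ≥0∞) + 1) ^ (-(r / p - 1))) := by
          rw [ENNReal.tsum_mul_left]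
          gcongr
          exact tsum_tail_rpow_le ha m
      _ ≤ v ^ r * (ENNReal.ofReal (1 + (r / p - 1)⁻¹) * (v ^ p) ^ (-(r / p - 1))) := by
          rw [ENNReal.rpow_neg ((m : ℝ≥0∞) + 1), ENNReal.rpow_neg (v ^ p)]
          gcongr
      _ = ENNReal.ofReal (1 + (r / p - 1)⁻¹) * v ^ p := by
          rw [mul_left_comm, ← ENNReal.rpow_mul, ← ENNReal.rpow_add _ _ hv0 hv]
          congr 2
          field_simp
          ring

/-- Terms of a convergent series tend to 0, so the truncation is eventually inactive. -/
lemma tsum_lt_top_of_tsum_min_one {a : ℕ → ℝ≥0∞} (ha : ∀ k, a k ≠ ∞)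
    (h : ∑' k, min 1 (a k) ≠ ∞) : ∑' k, a k < ∞ := by
  have hev := (ENNReal.tendsto_atTop_zero_of_tsum_ne_top h).eventually_lt_const
    (show (0 : ℝ≥0∞) < 1 by simp)
  obtain ⟨N, hN⟩ := Filter.eventually_atTop.1 hev
  rw [← ENNReal.summable.sum_add_tsum_nat_add' (k := N)]
  refine ENNReal.add_lt_top.2 ⟨ENNReal.sum_lt_top.2 fun k _ ↦ (ha k).lt_top, ?_⟩
  have : ∀ k, a (k + N) = min 1 (a (k + N)) := by
    intro k
    have := hN (k + N) (Nat.le_add_left _ _)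
    rw [min_lt_iff] at this
    exact (min_eq_right (this.resolve_left (lt_irrefl _)).le).symm
  rw [tsum_congr this]
  refine lt_of_le_of_lt ?_ h.lt_top
  exact ENNReal.tsum_comp_le_tsum_of_injective (add_left_injective N) _

/-- `u ≤ 1 + #{n : n + 1 < u}`. -/
lemma le_one_add_tsum_indicator (u : ℝ≥0∞) :
    u ≤ 1 + ∑' n : ℕ, if (n : ℝ≥0∞) + 1 < u then 1 else 0 := by
  refine ENNReal.le_of_forall_nnreal_lt fun x hx ↦ ?_
  have h1 : ∀ n ∈ Finset.range (⌈x⌉₊ - 1),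
      (1 : ℝ≥0∞) ≤ if (n : ℝ≥0∞) + 1 < u then 1 else 0 := by
    intro n hn
    rw [Finset.mem_range] at hn
    have : ((n + 1 : ℕ) : NNReal) < x := Nat.lt_ceil.1 (by omega)
    rw [if_pos]
    refine lt_trans ?_ hx
    exact_mod_cast this
  have h2 := (Finset.sum_le_sum h1).trans (ENNReal.sum_le_tsum (Finset.range (⌈x⌉₊ - 1)))
  refine le_trans ?_ (add_le_add_right h2 1)
  rw [Finset.sum_const, Finset.card_range, nsmul_eq_mul, mul_one]
  have : (x : ℝ≥0∞) ≤ ((⌈x⌉₊ : ℕ) : ℝ≥0∞) := by exact_mod_cast Nat.le_ceil x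
  refine this.trans ?_
  exact_mod_cast (by omega : ⌈x⌉₊ ≤ 1 + (⌈x⌉₊ - 1))

end PQStrongLaw

/-! ### Deterministic bounds for the weighted series. -/

namespace PQStrongLaw

variable {Ω B : Type*} [MeasurableSpace Ω] [NormedAddCommGroup B]

/-- The series `∑_{n ≥ 1} (1/n) (‖x_1 + ⋯ + x_n‖ / n^{1/p})^q` of a sequence `x` of vectors. -/
noncomputable def weightedSum (p q : ℝ) (x : ℕ → B) : ℝ≥0∞ :=
  ∑' n : ℕ, ((n : ℝ≥0∞) + 1) ^ (-(1 + q / p)) * ‖∑ k ∈ Finset.range (n + 1), x k‖ₑ ^ q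

lemma div_rpow_rpow {p q : ℝ} (hq : 0 < q) (n : ℕ) (v : ℝ≥0∞) :
    (v / ((n : ℝ≥0∞) + 1) ^ (1 / p)) ^ q = v ^ q * ((n : ℝ≥0∞) + 1) ^ (-(q / p)) := by
  rw [ENNReal.div_rpow_of_nonneg _ _ hq.le, ← ENNReal.rpow_mul, div_eq_mul_inv,
    ← ENNReal.rpow_neg]
  congr 2; ring

lemma inv_mul_normalizedPow {Ω : Type*} {p q : ℝ} (hq : 0 < q) (Xs : ℕ → Ω → B) (n : ℕ) (ω : Ω) :
    ((n + 1 : ℕ) : ℝ≥0∞)⁻¹ * normalizedPow p q Xs (n + 1) ω =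
      ((n : ℝ≥0∞) + 1) ^ (-(1 + q / p)) * ‖∑ k ∈ Finset.range (n + 1), Xs k ω‖ₑ ^ q := by
  have e : -(1 + q / p) = -1 + -(q / p) := by ring
  rw [normalizedPow, partialSum, Nat.cast_succ, div_rpow_rpow hq, e,
    ENNReal.rpow_add _ _ (succ_ne_zero' n) (succ_ne_top n), ENNReal.rpow_neg_one, mul_assoc,
    mul_comm (‖_‖ₑ ^ q)]

lemma weightedSum_le_of_le_one {p q : ℝ} (hp : 0 < p) (hq0 : 0 < q) (hq1 : q ≤ 1) (x : ℕ → B) :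
    weightedSum p q x ≤ ENNReal.ofReal (1 + (q / p)⁻¹) *
      ∑' k : ℕ, (‖x k‖ₑ / ((k : ℝ≥0∞) + 1) ^ (1 / p)) ^ q := by
  calc weightedSum p q x
      ≤ ∑' n : ℕ, ((n : ℝ≥0∞) + 1) ^ (-(1 + q / p)) *
          ∑ k ∈ Finset.range (n + 1), ‖x k‖ₑ ^ q := by
        refine ENNReal.tsum_le_tsum fun n ↦ ?_
        gcongr
        exact (ENNReal.rpow_le_rpow (enorm_sum_le _ _) hq0.le).trans
          (rpow_sum_le_sum_rpow hq0 hq1 _ _)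
    _ = ∑' k, ‖x k‖ₑ ^ q * ∑' n : ℕ, (((n + k : ℕ) : ℝ≥0∞) + 1) ^ (-(1 + q / p)) :=
        tsum_mul_sum_range_succ (fun n : ℕ ↦ ((n : ℝ≥0∞) + 1) ^ (-(1 + q / p))) _
    _ ≤ ∑' k : ℕ, ENNReal.ofReal (1 + (q / p)⁻¹) *
          (‖x k‖ₑ / ((k : ℝ≥0∞) + 1) ^ (1 / p)) ^ q := by
        refine ENNReal.tsum_le_tsum fun k ↦ ?_
        rw [div_rpow_rpow hq0, mul_left_comm]
        gcongr
        exact tsum_tail_rpow_le (div_pos hq0 hp) k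
    _ = _ := ENNReal.tsum_mul_left

/-- Weights `(k+1)^{1/p}` increase in `k`, so each partial sum is at most `G (n+1)^{1/p}` with `G`
the series on the right; this trades `q - 1` powers of the norm for `G ^ (q - 1)`. -/
lemma weightedSum_le_of_one_le {p q : ℝ} (hp : 0 < p) (hq1 : 1 ≤ q) (x : ℕ → B) :
    weightedSum p q x ≤
      (∑' k : ℕ, (‖x k‖ₑ / ((k : ℝ≥0∞) + 1) ^ (1 / p))) ^ (q - 1) * weightedSum p 1 x := by
  rw [weightedSum, weightedSum, ← ENNReal.tsum_mul_left]
  refine ENNReal.tsum_le_tsum fun n ↦ ?_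
  set G := ∑' k : ℕ, (‖x k‖ₑ / ((k : ℝ≥0∞) + 1) ^ (1 / p)) with hG
  have hS : ‖∑ k ∈ Finset.range (n + 1), x k‖ₑ ≤ G * ((n : ℝ≥0∞) + 1) ^ (1 / p) := by
    refine (enorm_sum_le _ _).trans ?_
    have h : ∀ k ∈ Finset.range (n + 1), ‖x k‖ₑ ≤
        ‖x k‖ₑ / ((k : ℝ≥0∞) + 1) ^ (1 / p) * ((n : ℝ≥0∞) + 1) ^ (1 / p) := by
      intro k hk
      have h0 : ((k : ℝ≥0∞) + 1) ^ (1 / p) ≠ 0 := by simp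
      have ht : ((k : ℝ≥0∞) + 1) ^ (1 / p) ≠ ∞ :=
        ENNReal.rpow_ne_top_of_nonneg (by positivity) (succ_ne_top k)
      calc ‖x k‖ₑ = ‖x k‖ₑ / ((k : ℝ≥0∞) + 1) ^ (1 / p) * ((k : ℝ≥0∞) + 1) ^ (1 / p) :=
            (ENNReal.div_mul_cancel h0 ht).symm
        _ ≤ _ := by
            gcongr
            exact_mod_cast Nat.lt_succ_iff.1 (Finset.mem_range.1 hk)
    refine (Finset.sum_le_sum h).trans ?_
    rw [← Finset.sum_mul]
    gcongr
    exact ENNReal.sum_le_tsum _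
  set v := ‖∑ k ∈ Finset.range (n + 1), x k‖ₑ
  have e1 : v ^ q = v ^ (q - 1) * v := by
    conv_rhs => rw [← ENNReal.rpow_one v, ← ENNReal.rpow_mul, one_mul,
      ← ENNReal.rpow_add_of_nonneg _ _ (by linarith) zero_le_one, sub_add_cancel]
  have e2 : ((n : ℝ≥0∞) + 1) ^ (-(1 + q / p)) * (((n : ℝ≥0∞) + 1) ^ (1 / p)) ^ (q - 1) =
      ((n : ℝ≥0∞) + 1) ^ (-(1 + 1 / p)) := by
    rw [← ENNReal.rpow_mul, ← ENNReal.rpow_add _ _ (succ_ne_zero' n) (succ_ne_top n)]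
    congr 1; ring
  calc ((n : ℝ≥0∞) + 1) ^ (-(1 + q / p)) * v ^ q
      ≤ ((n : ℝ≥0∞) + 1) ^ (-(1 + q / p)) *
          ((G * ((n : ℝ≥0∞) + 1) ^ (1 / p)) ^ (q - 1) * v) := by
        rw [e1]
        gcongr
    _ = G ^ (q - 1) * ((((n : ℝ≥0∞) + 1) ^ (-(1 + q / p)) *
          (((n : ℝ≥0∞) + 1) ^ (1 / p)) ^ (q - 1)) * v) := by
        rw [ENNReal.mul_rpow_of_nonneg _ _ (by linarith)]
        ring
    _ = _ := by rw [e2, ENNReal.rpow_one]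

/-! ### Sufficiency in (a), and statement (b). -/

variable [MeasurableSpace B] [BorelSpace B] {μ : Measure Ω} {p q : ℝ}
  {X : Ω → B} {Xs : ℕ → Ω → B}

lemma lintegral_comp_enorm_eq (h : ∀ n, IdentDistrib (Xs n) X μ μ) {g : ℝ≥0∞ → ℝ≥0∞}
    (hg : Measurable g) (n : ℕ) : ∫⁻ ω, g ‖Xs n ω‖ₑ ∂μ = ∫⁻ ω, g ‖X ω‖ₑ ∂μ :=
  ((h n).comp (hg.comp measurable_enorm)).lintegral_eq

/-- If `E ‖X‖^p < ∞`, then `∑ (‖X_k‖ / k^{1/p})^r < ∞` almost surely for every `r > p`. -/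
lemma ae_tsum_rpow_lt_top (hp : 0 < p) {r : ℝ} (hr : p < r)
    (h : ∀ n, IdentDistrib (Xs n) X μ μ) (hX : ∫⁻ ω, ‖X ω‖ₑ ^ p ∂μ < ∞) :
    ∀ᵐ ω ∂μ, ∑' k : ℕ, (‖Xs k ω‖ₑ / ((k : ℝ≥0∞) + 1) ^ (1 / p)) ^ r < ∞ := by
  have hr0 : 0 < r := hp.trans hr
  have hm : ∀ k : ℕ, Measurable fun v : ℝ≥0∞ ↦
      min 1 ((v / ((k : ℝ≥0∞) + 1) ^ (1 / p)) ^ r) := fun k ↦ by fun_prop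
  have hXm : AEMeasurable X μ := (h 0).aemeasurable_snd
  have hmY : ∀ {Y : Ω → B}, AEMeasurable Y μ → ∀ k : ℕ, AEMeasurable
      (fun ω ↦ min 1 ((‖Y ω‖ₑ / ((k : ℝ≥0∞) + 1) ^ (1 / p)) ^ r)) μ :=
    fun hY k ↦ (hm k).comp_aemeasurable hY.enorm
  have hint : ∫⁻ ω, ∑' k : ℕ, min 1 ((‖Xs k ω‖ₑ / ((k : ℝ≥0∞) + 1) ^ (1 / p)) ^ r) ∂μ ≠ ∞ := by
    rw [lintegral_tsum fun k ↦ hmY (h k).aemeasurable_fst k]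
    -- After Tonelli only the marginal laws matter, so every `Xs k` may be replaced by the same `X`
    -- before summing pointwise.
    simp_rw [fun k ↦ lintegral_comp_enorm_eq h (hm k) k]
    rw [← lintegral_tsum fun k ↦ hmY hXm k]
    refine ne_top_of_le_ne_top ?_
      (lintegral_mono fun ω ↦ tsum_min_one_le hp hr (v := ‖X ω‖ₑ) enorm_ne_top)
    rw [lintegral_const_mul' _ _ (by simp)]
    exact ENNReal.mul_ne_top (by simp) hX.ne
  have hae := ae_lt_top' (AEMeasurable.tsum fun k ↦ hmY (h k).aemeasurable_fst k) hint
  filter_upwards [hae] with ω hω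
  refine tsum_lt_top_of_tsum_min_one (fun k ↦ ?_) hω.ne
  exact ENNReal.rpow_ne_top_of_nonneg hr0.le (ENNReal.div_ne_top enorm_ne_top (by simp))

lemma ae_weightedSum_lt_top (hp0 : 0 < p) (hp1 : p < 1) (hpq : p < q)
    (h : ∀ n, IdentDistrib (Xs n) X μ μ) (hX : ∫⁻ ω, ‖X ω‖ₑ ^ p ∂μ < ∞) :
    ∀ᵐ ω ∂μ, weightedSum p q (fun k ↦ Xs k ω) < ∞ := by
  rcases le_total q 1 with hq | hq
  · filter_upwards [ae_tsum_rpow_lt_top hp0 hpq h hX] with ω hω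
    exact (weightedSum_le_of_le_one hp0 (hp0.trans hpq) hq _).trans_lt
      (ENNReal.mul_lt_top ENNReal.ofReal_lt_top hω)
  -- Here `p < 1` is essential: the exponent `r = 1` must exceed `p`.
  · filter_upwards [ae_tsum_rpow_lt_top hp0 hp1 h hX] with ω hω
    have h1 := (weightedSum_le_of_le_one hp0 one_pos le_rfl fun k ↦ Xs k ω).trans_lt
      (ENNReal.mul_lt_top ENNReal.ofReal_lt_top hω)
    simp only [ENNReal.rpow_one] at hω
    exact (weightedSum_le_of_one_le hp0 hq _).trans_lt
      (ENNReal.mul_lt_top (ENNReal.rpow_lt_top_of_nonneg (by linarith) hω.ne) h1)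

lemma lintegral_enorm_sum_rpow_le (hq : 0 < q)
    (h : ∀ n, IdentDistrib (Xs n) X μ μ) (n : ℕ) :
    ∫⁻ ω, ‖∑ k ∈ Finset.range (n + 1), Xs k ω‖ₑ ^ q ∂μ ≤
      ((n : ℝ≥0∞) + 1) ^ (max q 1) * ∫⁻ ω, ‖X ω‖ₑ ^ q ∂μ := by
  have hpt : ∀ ω, ‖∑ k ∈ Finset.range (n + 1), Xs k ω‖ₑ ^ q ≤
      ((n : ℝ≥0∞) + 1) ^ (max q 1 - 1) * ∑ k ∈ Finset.range (n + 1), ‖Xs k ω‖ₑ ^ q := by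
    intro ω
    refine (ENNReal.rpow_le_rpow (enorm_sum_le _ _) hq.le).trans ?_
    rcases le_total q 1 with hq1 | hq1
    · simpa [max_eq_right hq1] using rpow_sum_le_sum_rpow hq hq1 (Finset.range (n + 1)) _
    · rw [max_eq_left hq1]
      simpa using ENNReal.rpow_sum_le_const_mul_sum_rpow (Finset.range (n + 1))
        (fun k ↦ ‖Xs k ω‖ₑ) hq1
  refine (lintegral_mono hpt).trans (le_of_eq ?_)
  have hm : Measurable fun v : ℝ≥0∞ ↦ v ^ q := by fun_prop
  have hmX : ∀ k, AEMeasurable (fun ω ↦ ‖Xs k ω‖ₑ ^ q) μ :=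
    fun k ↦ hm.comp_aemeasurable (h k).aemeasurable_fst.enorm
  rw [lintegral_const_mul'' _ (Finset.aemeasurable_fun_sum _ fun k _ ↦ hmX k),
    lintegral_finsetSum' _ fun k _ ↦ hmX k]
  simp_rw [fun k ↦ lintegral_comp_enorm_eq h hm k]
  rw [Finset.sum_const, Finset.card_range, nsmul_eq_mul, ← mul_assoc]
  congr 1
  conv_lhs => rw [Nat.cast_succ, ← ENNReal.rpow_one ((n : ℝ≥0∞) + 1), ← ENNReal.rpow_mul, one_mul,
    ← ENNReal.rpow_add _ _ (succ_ne_zero' n) (succ_ne_top n), sub_add_cancel]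

lemma tsum_lintegral_lt_top_iff (hp0 : 0 < p) (hp1 : p < 1) (hpq : p < q)
    (h : ∀ n, IdentDistrib (Xs n) X μ μ) :
    ∑' n : ℕ, ((n + 1 : ℕ) : ℝ≥0∞)⁻¹ * ∫⁻ ω, normalizedPow p q Xs (n + 1) ω ∂μ < ∞ ↔
      ∫⁻ ω, ‖X ω‖ₑ ^ q ∂μ < ∞ := by
  have hq : 0 < q := hp0.trans hpq
  have hterm : ∀ n : ℕ, ((n + 1 : ℕ) : ℝ≥0∞)⁻¹ * ∫⁻ ω, normalizedPow p q Xs (n + 1) ω ∂μ =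
      ((n : ℝ≥0∞) + 1) ^ (-(1 + q / p)) *
        ∫⁻ ω, ‖∑ k ∈ Finset.range (n + 1), Xs k ω‖ₑ ^ q ∂μ := by
    intro n
    rw [← lintegral_const_mul' _ _ (by simp), ← lintegral_const_mul' _ _ ?_]
    · simp_rw [inv_mul_normalizedPow hq]
    · simp
  simp_rw [hterm]
  constructor
  · intro hsum
    -- The term of `S_1` alone is the required moment.
    have := (ENNReal.le_tsum 0).trans_lt hsum
    simpa [lintegral_comp_enorm_eq h (g := fun v ↦ v ^ q) (by fun_prop) 0] using this
  · intro hX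
    -- This makes the exponent `max q 1 - (1 + q / p)` of the majorant less than `-1`.
    have hmax : max q 1 < q / p := by
      rw [lt_div_iff₀ hp0]
      rcases le_total q 1 with h1 | h1
      · rw [max_eq_right h1]; linarith
      · rw [max_eq_left h1]; nlinarith
    calc ∑' n : ℕ, ((n : ℝ≥0∞) + 1) ^ (-(1 + q / p)) *
          ∫⁻ ω, ‖∑ k ∈ Finset.range (n + 1), Xs k ω‖ₑ ^ q ∂μ
        ≤ ∑' n : ℕ, ((n : ℝ≥0∞) + 1) ^ (max q 1 - (1 + q / p)) * ∫⁻ ω, ‖X ω‖ₑ ^ q ∂μ := by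
          refine ENNReal.tsum_le_tsum fun n ↦ ?_
          have e : max q 1 - (1 + q / p) = -(1 + q / p) + max q 1 := by ring
          rw [e, ENNReal.rpow_add _ _ (succ_ne_zero' n) (succ_ne_top n), mul_assoc]
          gcongr
          exact lintegral_enorm_sum_rpow_le hq h n
      _ < ∞ := by
          rw [ENNReal.tsum_mul_right]
          exact ENNReal.mul_lt_top (tsum_rpow_lt_top (by linarith)) hX


/-! ### Lévy-type inequality. -/

/-- A Lévy-type maximal inequality: `T j` is a measure-preserving map which leaves all `g i`
invariant, and `g j` is controlled by `H` before and after applying `T j`. -/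
lemma measure_exists_lt_le_two_mul {E : Type*} [MeasurableSpace E] {P : Measure E}
    {T : ℕ → E → E} (hT : ∀ j, MeasurePreserving (T j) P P)
    {g : ℕ → E → ℝ≥0∞} (hg : ∀ j, Measurable (g j)) (hgT : ∀ i j x, g i (T j x) = g i x)
    {H : E → ℝ≥0∞} (hH : Measurable H) {C : ℝ≥0∞}
    (hle : ∀ j x, g j x ≤ C * (H x + H (T j x))) (t : ℝ≥0∞) :
    P {x | ∃ j, C * (t + t) < g j x} ≤ 2 * P {x | t < H x} := by
  set U : ℕ → Set E := fun j ↦ {x | C * (t + t) < g j x} with hU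
  set V : Set E := {x | t < H x}
  have hUm : ∀ j, MeasurableSet (U j) := fun j ↦ measurableSet_lt measurable_const (hg j)
  have hVm : MeasurableSet V := measurableSet_lt measurable_const hH
  have hAm : ∀ j, MeasurableSet (disjointed U j) := fun j ↦ MeasurableSet.disjointed hUm j
  -- `disjointed U j` says that `j` is the first index of exceedance. It depends only on the `g i`,
  -- hence is `T j`-invariant.
  have hinv : ∀ j x, T j x ∈ disjointed U j ↔ x ∈ disjointed U j := by
    intro j x
    simp only [disjointed_eq_inter_compl, Set.mem_inter_iff, Set.mem_iInter, Set.mem_compl_iff,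
      hU, Set.mem_ofPred_eq, hgT]
  -- On this event `H` exceeds `t` at `x` or at `T j x`; both alternatives have the same measure,
  -- whence the factor 2.
  have hsub : ∀ j, disjointed U j ⊆
      (disjointed U j ∩ V) ∪ T j ⁻¹' (disjointed U j ∩ V) := by
    intro j x hx
    by_cases h1 : t < H x
    · exact Or.inl ⟨hx, h1⟩
    · refine Or.inr ⟨(hinv j x).2 hx, ?_⟩
      by_contra h2
      have h3 : C * (t + t) < g j x := disjointed_subset U j hx
      refine absurd ((hle j x).trans ?_) h3.not_ge
      gcongr
      · exact not_lt.1 h1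
      · exact not_lt.1 h2
  have hunion : {x | ∃ j, C * (t + t) < g j x} = ⋃ j, disjointed U j := by
    rw [iUnion_disjointed]; ext x; simp [hU]
  rw [hunion]
  calc P (⋃ j, disjointed U j) ≤ ∑' j, P (disjointed U j) := measure_iUnion_le _
    _ ≤ ∑' j, 2 * P (disjointed U j ∩ V) := by
        refine ENNReal.tsum_le_tsum fun j ↦ ?_
        refine (measure_mono (hsub j)).trans ((measure_union_le _ _).trans (le_of_eq ?_))
        rw [(hT j).measure_preimage ((hAm j).inter hVm).nullMeasurableSet, two_mul]
    _ = 2 * P (⋃ j, disjointed U j ∩ V) := by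
        rw [ENNReal.tsum_mul_left, measure_iUnion _ fun j ↦ (hAm j).inter hVm]
        exact fun i j hij ↦ ((disjoint_disjointed U) hij).mono Set.inter_subset_left
          Set.inter_subset_left
    _ ≤ 2 * P V := by
        gcongr
        exact Set.iUnion_subset fun j ↦ Set.inter_subset_right

lemma exists_measure_lt_lt {E : Type*} [MeasurableSpace E] {P : Measure E} [IsFiniteMeasure P]
    {H : E → ℝ≥0∞} (hH : Measurable H) (hfin : ∀ᵐ x ∂P, H x < ∞) {ε : ℝ≥0∞} (hε : 0 < ε) :
    ∃ t : ℕ, P {x | (t : ℝ≥0∞) < H x} < ε := by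
  have h := tendsto_measure_iInter_atTop (μ := P) (s := fun t : ℕ ↦ {x | (t : ℝ≥0∞) < H x})
    (fun t ↦ (measurableSet_lt measurable_const hH).nullMeasurableSet)
    (fun s t hst x (hx : (t : ℝ≥0∞) < H x) ↦
      show (s : ℝ≥0∞) < H x from lt_of_le_of_lt (by exact_mod_cast hst) hx) ⟨0, measure_ne_top _ _⟩
  have h0 : P (⋂ t : ℕ, {x | (t : ℝ≥0∞) < H x}) = 0 := by
    refine measure_mono_null (fun x hx ↦ ?_) (ae_iff.1 hfin)
    rw [Set.mem_ofPred_eq, not_lt, top_le_iff]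
    refine ENNReal.eq_top_of_forall_nnreal_le fun r ↦ ?_
    obtain ⟨n, hn⟩ := exists_nat_ge r
    have := Set.mem_iInter.1 hx n
    exact le_trans (by exact_mod_cast hn) (le_of_lt this)
  rw [h0] at h
  exact (h.eventually_lt_const hε).exists

/-! ### Symmetrization by swapping within pairs. -/

variable {B : Type*} [NormedAddCommGroup B]

/-- The sequence `x_0 - x_1, x_2 - x_3, …`. -/
def pairDiff (x : ℕ → B) (n : ℕ) : B := x (2 * n) - x (2 * n + 1)

/-- The permutation of `ℕ` that exchanges `2n` and `2n+1` for all `n ≠ j`. -/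
def swapExcept (j m : ℕ) : ℕ := if m / 2 = j then m else 2 * (m / 2) + (1 - m % 2)

lemma swapExcept_injective (j : ℕ) : Function.Injective (swapExcept j) := by
  intro a b h
  unfold swapExcept at h
  split_ifs at h <;> omega

lemma pairDiff_comp_swapExcept (x : ℕ → B) (j n : ℕ) :
    pairDiff (fun m ↦ x (swapExcept j m)) n = if n = j then pairDiff x n else -pairDiff x n := by
  have h1 : 2 * n / 2 = n := by omega
  have h2 : (2 * n + 1) / 2 = n := by omega
  have h3 : 2 * n % 2 = 0 := by omega
  have h4 : (2 * n + 1) % 2 = 1 := by omega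
  simp only [pairDiff, swapExcept, h1, h2, h3, h4]
  split_ifs <;> simp

lemma pairDiff_add_pairDiff_comp_swapExcept (x : ℕ → B) (j : ℕ) :
    pairDiff x + pairDiff (fun m ↦ x (swapExcept j m)) =
      Pi.single j (pairDiff x j + pairDiff x j) := by
  ext n
  rw [Pi.add_apply, pairDiff_comp_swapExcept]
  rcases eq_or_ne n j with rfl | h
  · simp
  · simp [h]

lemma weightedSum_add_le {p q : ℝ} (hq : 0 ≤ q) (x y : ℕ → B) :
    weightedSum p q (x + y) ≤ 2 ^ q * (weightedSum p q x + weightedSum p q y) := by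
  rw [weightedSum, weightedSum, weightedSum, ← ENNReal.tsum_add, ← ENNReal.tsum_mul_left]
  refine ENNReal.tsum_le_tsum fun n ↦ ?_
  rw [← mul_add, mul_left_comm]
  gcongr
  simp only [Pi.add_apply, Finset.sum_add_distrib]
  exact (ENNReal.rpow_le_rpow (enorm_add_le _ _) hq).trans (add_rpow_le hq _ _)

lemma weightedSum_neg (p q : ℝ) (x : ℕ → B) : weightedSum p q (-x) = weightedSum p q x := by
  simp [weightedSum]

lemma le_weightedSum_single {p q : ℝ} (hp : 0 < p) (hq : 0 < q) (j : ℕ) (b : B) :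
    2 ^ (-(1 + q / p)) * (‖b‖ₑ / ((j : ℝ≥0∞) + 1) ^ (1 / p)) ^ q ≤
      weightedSum p q (Pi.single j b) := by
  have h : ∀ n : ℕ, ‖∑ k ∈ Finset.range (n + 1), (Pi.single j b : ℕ → B) k‖ₑ ^ q =
      ∑ k ∈ Finset.range (n + 1), (Pi.single j (‖b‖ₑ ^ q) : ℕ → ℝ≥0∞) k := by
    intro n
    rw [Finset.sum_pi_single', Finset.sum_pi_single']
    split_ifs <;> simp [hq]
  rw [weightedSum]
  simp_rw [h]
  rw [tsum_mul_sum_range_succ (fun n : ℕ ↦ ((n : ℝ≥0∞) + 1) ^ (-(1 + q / p)))]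
  refine le_trans ?_ (ENNReal.le_tsum j)
  rw [Pi.single_eq_same, div_rpow_rpow hq, mul_left_comm]
  gcongr
  exact le_tsum_tail_rpow (div_pos hq hp) j

/-- Supplies the domination hypothesis of the Lévy-type inequality: the sum of the two difference
sequences is supported at `j`. -/
lemma le_weightedSum_pairDiff [NormedSpace ℝ B] {p q : ℝ} (hp : 0 < p) (hq : 0 < q) (j : ℕ)
    (x : ℕ → B) :
    2 ^ (-(1 + q / p)) * (‖pairDiff x j‖ₑ / ((j : ℝ≥0∞) + 1) ^ (1 / p)) ^ q ≤
      2 ^ q * (weightedSum p q (pairDiff x) +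
        weightedSum p q (pairDiff fun m ↦ x (swapExcept j m))) := by
  refine le_trans ?_ (weightedSum_add_le hq.le _ _)
  rw [pairDiff_add_pairDiff_comp_swapExcept]
  refine le_trans ?_ (le_weightedSum_single hp hq j _)
  gcongr
  rw [← two_smul ℝ, enorm_smul]
  refine le_mul_of_one_le_left' ?_
  rw [← ofReal_norm]
  simp

variable [MeasurableSpace B]

lemma measurePreserving_infinitePi_comp {B : Type*} [MeasurableSpace B] (ν : Measure B)
    [IsProbabilityMeasure ν] {f : ℕ → ℕ}
    (hf : Function.Injective f) :
    MeasurePreserving (fun (x : ℕ → B) m ↦ x (f m)) (Measure.infinitePi fun _ ↦ ν)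
      (Measure.infinitePi fun _ ↦ ν) :=
  ⟨by fun_prop, Measure.map_infinitePi_infinitePi_of_inj (P := fun _ ↦ ν) hf⟩

/-- The even and the odd coordinates each have the law of the full sequence. -/
lemma ae_weightedSum_pairDiff_lt_top {ν : Measure B} [IsProbabilityMeasure ν] {p q : ℝ}
    (hq : 0 < q)
    (h : ∀ᵐ x ∂(Measure.infinitePi fun _ : ℕ ↦ ν), weightedSum p q x < ∞) :
    ∀ᵐ x ∂(Measure.infinitePi fun _ : ℕ ↦ ν), weightedSum p q (pairDiff x) < ∞ := by
  have h1 := (measurePreserving_infinitePi_comp ν (f := fun m ↦ 2 * m)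
    fun a b hab ↦ by simpa using hab).quasiMeasurePreserving.ae h
  have h2 := (measurePreserving_infinitePi_comp ν (f := fun m ↦ 2 * m + 1)
    fun a b hab ↦ by simpa using hab).quasiMeasurePreserving.ae h
  filter_upwards [h1, h2] with x hx1 hx2
  have e : pairDiff x = (fun m ↦ x (2 * m)) + -(fun m ↦ x (2 * m + 1)) := by
    ext n; simp [pairDiff, sub_eq_add_neg]
  rw [e]
  refine (weightedSum_add_le hq.le _ _).trans_lt ?_
  rw [weightedSum_neg]
  exact ENNReal.mul_lt_top (ENNReal.rpow_lt_top_of_nonneg hq.le (by simp))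
    (ENNReal.add_lt_top.2 ⟨hx1, hx2⟩)

variable [BorelSpace B]

lemma measurable_weightedSum [SecondCountableTopology B] (p q : ℝ) :
    Measurable (weightedSum p q : (ℕ → B) → ℝ≥0∞) := by
  refine Measurable.tsum fun n ↦ ?_
  fun_prop

lemma measurable_pairDiff [SecondCountableTopology B] :
    Measurable (pairDiff : (ℕ → B) → ℕ → B) := by
  unfold pairDiff
  fun_prop

/-- If the series converges almost surely, then for some finite `K`, with positive probability,
`‖x_{2n} - x_{2n+1}‖ ≤ K (n+1)^{1/p}` for all `n`. -/
lemma exists_measure_exists_pairDiff_lt_one [NormedSpace ℝ B] [SecondCountableTopology B]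
    {ν : Measure B} [IsProbabilityMeasure ν] {p q : ℝ} (hp : 0 < p) (hq : 0 < q)
    (h : ∀ᵐ x ∂(Measure.infinitePi fun _ : ℕ ↦ ν), weightedSum p q x < ∞) :
    ∃ K : ℝ≥0∞, K ≠ ∞ ∧ (Measure.infinitePi fun _ : ℕ ↦ ν)
      {x | ∃ j : ℕ, K * ((j : ℝ≥0∞) + 1) ^ (1 / p) < ‖pairDiff x j‖ₑ} < 1 := by
  set P := Measure.infinitePi fun _ : ℕ ↦ ν
  have hHm : Measurable fun x : ℕ → B ↦ weightedSum p q (pairDiff x) :=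
    (measurable_weightedSum p q).comp measurable_pairDiff
  -- Below one half, so that the Lévy factor 2 still leaves probability less than 1.
  obtain ⟨t, ht⟩ := exists_measure_lt_lt hHm (ae_weightedSum_pairDiff_lt_top hq h)
    (show (0 : ℝ≥0∞) < 2⁻¹ by simp)
  have hlevy := measure_exists_lt_le_two_mul
    (fun j ↦ measurePreserving_infinitePi_comp ν (swapExcept_injective j))
    (g := fun j x ↦ 2 ^ (-(1 + q / p)) * (‖pairDiff x j‖ₑ / ((j : ℝ≥0∞) + 1) ^ (1 / p)) ^ q)
    (fun j ↦ by
      have : Measurable fun x : ℕ → B ↦ pairDiff x j := by unfold pairDiff; fun_prop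
      fun_prop)
    (fun i j x ↦ by
      rw [pairDiff_comp_swapExcept]
      split_ifs <;> simp)
    hHm (fun j x ↦ le_weightedSum_pairDiff hp hq j x) t
  have hc0 : (2 : ℝ≥0∞) ^ (-(1 + q / p)) ≠ 0 := by simp
  have hct : (2 : ℝ≥0∞) ^ (-(1 + q / p)) ≠ ∞ := by simp
  refine ⟨((2 ^ (-(1 + q / p)))⁻¹ * (2 ^ q * (t + t))) ^ q⁻¹, ?_, ?_⟩
  · refine ENNReal.rpow_ne_top_of_nonneg (by positivity) (ENNReal.mul_ne_top (by simp)
      (ENNReal.mul_ne_top (ENNReal.rpow_ne_top_of_nonneg hq.le (by simp)) (by simp)))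
  refine lt_of_le_of_lt (measure_mono ?_) (hlevy.trans_lt ?_)
  · rintro x ⟨j, hj⟩
    refine ⟨j, ?_⟩
    rw [← ENNReal.lt_div_iff_mul_lt (Or.inl (by simp)) (Or.inl
      (ENNReal.rpow_ne_top_of_nonneg (by positivity) (succ_ne_top j))),
      ENNReal.rpow_inv_lt_iff hq, ← ENNReal.div_eq_inv_mul,
      ENNReal.div_lt_iff (Or.inl hc0) (Or.inl hct)] at hj
    rwa [mul_comm (2 ^ (-(1 + q / p)))]
  · calc 2 * P {x | (t : ℝ≥0∞) < weightedSum p q (pairDiff x)} < 2 * 2⁻¹ := by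
          rw [ENNReal.mul_lt_mul_iff_right (by simp) (by simp)]
          exact ht
      _ = 1 := ENNReal.mul_inv_cancel (by simp) (by simp)

end PQStrongLaw

namespace PQStrongLaw

/-! ### Independence of events on disjoint pairs. -/

section Pairs

variable {B : Type*} [MeasurableSpace B] (ν : Measure B) [IsProbabilityMeasure ν]
  {A A' : ℕ → Set B}

lemma infinitePi_biInter_pairs (hA : ∀ n, MeasurableSet (A n)) (hA' : ∀ n, MeasurableSet (A' n))
    (s : Finset ℕ) :
    (Measure.infinitePi fun _ : ℕ ↦ ν)
      (⋂ n ∈ s, {x | x (2 * n) ∈ A n ∧ x (2 * n + 1) ∈ A' n}) =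
      ∏ n ∈ s, ν (A n) * ν (A' n) := by
  -- Interleaving the two families turns the intersection into a finite-dimensional box.
  set t : ℕ → Set B := fun m ↦ if m % 2 = 0 then A (m / 2) else A' (m / 2) with ht
  have ht0 : ∀ n, t (2 * n) = A n := fun n ↦ by
    rw [ht]; simp
  have ht1 : ∀ n, t (2 * n + 1) = A' n := fun n ↦ by
    have h2 : (2 * n + 1) / 2 = n := by omega
    have h4 : (2 * n + 1) % 2 = 1 := by omega
    simp [ht, h2, h4]
  have hset : (⋂ n ∈ s, {x : ℕ → B | x (2 * n) ∈ A n ∧ x (2 * n + 1) ∈ A' n}) =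
      Set.pi ((s.image (fun n ↦ 2 * n) ∪ s.image (fun n ↦ 2 * n + 1) : Finset ℕ) : Set ℕ) t := by
    ext x
    simp only [Set.mem_iInter, Set.mem_pi, Finset.mem_coe, Finset.mem_union, Finset.mem_image]
    constructor
    · rintro h m (⟨n, hn, rfl⟩ | ⟨n, hn, rfl⟩)
      · rw [ht0]; exact (h n hn).1
      · rw [ht1]; exact (h n hn).2
    · intro h n hn
      exact ⟨ht0 n ▸ h _ (Or.inl ⟨n, hn, rfl⟩), ht1 n ▸ h _ (Or.inr ⟨n, hn, rfl⟩)⟩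
  rw [hset, Measure.infinitePi_pi]
  · rw [Finset.prod_union, Finset.prod_image (fun a _ b _ hab ↦ by simpa using hab),
      Finset.prod_image (fun a _ b _ hab ↦ by simpa using hab), ← Finset.prod_mul_distrib]
    · simp_rw [ht0, ht1]
    · rw [Finset.disjoint_left]
      intro m hm hm'
      simp only [Finset.mem_image] at hm hm'
      obtain ⟨a, -, rfl⟩ := hm
      obtain ⟨b, -, hb⟩ := hm'
      omega
  · intro m _
    rw [ht]
    dsimp only
    split_ifs
    exacts [hA _, hA' _]

lemma infinitePi_pair (hA : ∀ n, MeasurableSet (A n)) (hA' : ∀ n, MeasurableSet (A' n)) (n : ℕ) :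
    (Measure.infinitePi fun _ : ℕ ↦ ν) {x | x (2 * n) ∈ A n ∧ x (2 * n + 1) ∈ A' n} =
      ν (A n) * ν (A' n) := by
  simpa using infinitePi_biInter_pairs ν hA hA' {n}

lemma measurableSet_pair (hA : ∀ n, MeasurableSet (A n)) (hA' : ∀ n, MeasurableSet (A' n))
    (n : ℕ) : MeasurableSet {x : ℕ → B | x (2 * n) ∈ A n ∧ x (2 * n + 1) ∈ A' n} :=
  (measurable_pi_apply (2 * n) (hA n)).inter (measurable_pi_apply (2 * n + 1) (hA' n))

lemma iIndepSet_pairs (hA : ∀ n, MeasurableSet (A n)) (hA' : ∀ n, MeasurableSet (A' n)) :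
    iIndepSet (fun n ↦ {x : ℕ → B | x (2 * n) ∈ A n ∧ x (2 * n + 1) ∈ A' n})
      (Measure.infinitePi fun _ : ℕ ↦ ν) := by
  rw [iIndepSet_iff_meas_biInter (measurableSet_pair hA hA')]
  intro s
  rw [infinitePi_biInter_pairs ν hA hA']
  simp_rw [infinitePi_pair ν hA hA']

end Pairs

/-! ### Borel–Cantelli and necessity in (a). -/

variable {B : Type*} [NormedAddCommGroup B] [MeasurableSpace B] [BorelSpace B]

lemma lintegral_enorm_rpow_lt_top_of_tsum {p : ℝ} (hp : 0 < p) {ν : Measure B} [IsFiniteMeasure ν]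
    {L : ℝ≥0∞} (hL0 : L ≠ 0) (hL : L ≠ ∞)
    (h : ∑' n : ℕ, ν {b | L * ((n : ℝ≥0∞) + 1) ^ (1 / p) < ‖b‖ₑ} < ∞) :
    ∫⁻ b, ‖b‖ₑ ^ p ∂ν < ∞ := by
  have hms : ∀ n : ℕ, MeasurableSet {b : B | L * ((n : ℝ≥0∞) + 1) ^ (1 / p) < ‖b‖ₑ} :=
    fun n ↦ measurableSet_lt measurable_const measurable_enorm
  have hpt : ∀ b : B, ‖b‖ₑ ^ p ≤ L ^ p * (1 + ∑' n : ℕ,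
      {b : B | L * ((n : ℝ≥0∞) + 1) ^ (1 / p) < ‖b‖ₑ}.indicator 1 b) := by
    intro b
    have e : ‖b‖ₑ ^ p = L ^ p * (‖b‖ₑ / L) ^ p := by
      rw [← ENNReal.mul_rpow_of_nonneg _ _ hp.le, ENNReal.mul_div_cancel hL0 hL]
    rw [e]
    gcongr
    refine (le_one_add_tsum_indicator _).trans (le_of_eq ?_)
    congr 1
    refine tsum_congr fun n ↦ ?_
    rw [Set.indicator_apply]
    refine if_congr ?_ rfl rfl
    rw [Set.mem_ofPred_eq, one_div, mul_comm, ← ENNReal.lt_div_iff_mul_lt (Or.inl hL0) (Or.inl hL),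
      ENNReal.rpow_inv_lt_iff hp]
  refine (lintegral_mono hpt).trans_lt ?_
  rw [lintegral_const_mul' _ _ (ENNReal.rpow_ne_top_of_nonneg hp.le hL),
    lintegral_add_left measurable_const,
    lintegral_tsum fun n ↦ (measurable_one.indicator (hms n)).aemeasurable]
  simp_rw [lintegral_indicator_one (hms _)]
  refine ENNReal.mul_lt_top (ENNReal.rpow_lt_top_of_nonneg hp.le hL)
    (ENNReal.add_lt_top.2 ⟨?_, h⟩)
  simp

lemma lintegral_enorm_rpow_lt_top [NormedSpace ℝ B] [SecondCountableTopology B]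
    {ν : Measure B} [IsProbabilityMeasure ν] {p q : ℝ} (hp : 0 < p) (hq : 0 < q)
    (h : ∀ᵐ x ∂(Measure.infinitePi fun _ : ℕ ↦ ν), weightedSum p q x < ∞) :
    ∫⁻ b, ‖b‖ₑ ^ p ∂ν < ∞ := by
  obtain ⟨K, hK, hP⟩ := exists_measure_exists_pairDiff_lt_one hp hq h
  -- Desymmetrization: the odd coordinate has norm at most `M` with positive probability, and then a
  -- large even coordinate forces a large difference.
  obtain ⟨M, hM⟩ := exists_measure_lt_lt (P := ν) (H := fun b ↦ ‖b‖ₑ) measurable_enorm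
    (by simp) one_pos
  -- The `+ 1` only ensures `L ≠ 0`.
  set L : ℝ≥0∞ := K + M + 1 with hL
  set A : ℕ → Set B := fun n ↦ {b | L * ((n : ℝ≥0∞) + 1) ^ (1 / p) < ‖b‖ₑ}
  set A' : ℕ → Set B := fun _ ↦ {b | ‖b‖ₑ ≤ M}
  have hA : ∀ n, MeasurableSet (A n) :=
    fun n ↦ measurableSet_lt measurable_const measurable_enorm
  have hA' : ∀ n, MeasurableSet (A' n) :=
    fun n ↦ measurableSet_le measurable_enorm measurable_const
  have hA'pos : ∀ n, ν (A' n) = ν (A' 0) := fun _ ↦ rfl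
  have hpos : ν (A' 0) ≠ 0 := by
    intro h0
    have hc : (A' 0)ᶜ = {b : B | (M : ℝ≥0∞) < ‖b‖ₑ} := by ext; simp [A']
    rw [← hc, prob_compl_eq_one_sub (hA' 0), h0] at hM
    simp at hM
  have hsub : ∀ n x, x ∈ {x : ℕ → B | x (2 * n) ∈ A n ∧ x (2 * n + 1) ∈ A' n} →
      K * ((n : ℝ≥0∞) + 1) ^ (1 / p) < ‖pairDiff x n‖ₑ := by
    rintro n x ⟨h1, h2⟩
    by_contra hcon
    refine not_lt.2 ?_ (show L * ((n : ℝ≥0∞) + 1) ^ (1 / p) < ‖x (2 * n)‖ₑ from h1)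
    have h2' : ‖x (2 * n + 1)‖ₑ ≤ M := h2
    have hone : (1 : ℝ≥0∞) ≤ ((n : ℝ≥0∞) + 1) ^ (1 / p) :=
      ENNReal.one_le_rpow le_add_self (by positivity)
    calc ‖x (2 * n)‖ₑ = ‖pairDiff x n + x (2 * n + 1)‖ₑ := by simp [pairDiff]
      _ ≤ ‖pairDiff x n‖ₑ + ‖x (2 * n + 1)‖ₑ := enorm_add_le _ _
      _ ≤ K * ((n : ℝ≥0∞) + 1) ^ (1 / p) + M * ((n : ℝ≥0∞) + 1) ^ (1 / p) := by
          gcongr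
          · exact not_lt.1 hcon
          · exact h2'.trans (le_mul_of_one_le_right' hone)
      _ = (K + M) * ((n : ℝ≥0∞) + 1) ^ (1 / p) := (add_mul _ _ _).symm
      _ ≤ L * ((n : ℝ≥0∞) + 1) ^ (1 / p) := by gcongr; exact le_self_add
  have hsum : ∑' n, (Measure.infinitePi fun _ : ℕ ↦ ν)
      {x | x (2 * n) ∈ A n ∧ x (2 * n + 1) ∈ A' n} ≠ ∞ := by
    intro hinf
    -- Divergence would make some difference exceed its bound almost surely, contradicting `hP`.
    have h1 := measure_limsup_eq_one (measurableSet_pair hA hA') (iIndepSet_pairs ν hA hA') hinf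
    refine hP.not_ge (h1.ge.trans (measure_mono fun x hx ↦ ?_))
    rw [Filter.mem_limsup_iff_frequently_mem] at hx
    obtain ⟨n, hn⟩ := hx.exists
    exact ⟨n, hsub n x hn⟩
  simp_rw [infinitePi_pair ν hA hA', hA'pos] at hsum
  rw [ENNReal.tsum_mul_right] at hsum
  refine lintegral_enorm_rpow_lt_top_of_tsum hp (L := L) (by simp [hL]) (by simp [hL, hK]) ?_
  refine lt_top_iff_ne_top.2 fun hinf ↦ hsum ?_
  rw [ENNReal.mul_eq_top]
  exact Or.inr ⟨hinf, hpos⟩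

/-- Independence enters here: it identifies the law of the sequence with the infinite product, where
coordinate permutations are available. -/
lemma lintegral_enorm_rpow_lt_top_of_ae_weightedSum {Ω : Type*} [MeasurableSpace Ω] {μ : Measure Ω}
    [IsProbabilityMeasure μ] [NormedSpace ℝ B] [SecondCountableTopology B] {p q : ℝ}
    (hp : 0 < p) (hq : 0 < q) {X : Ω → B} {Xs : ℕ → Ω → B} (hXs : IsIndepCopies μ X Xs)
    (h : ∀ᵐ ω ∂μ, weightedSum p q (fun k ↦ Xs k ω) < ∞) :
    ∫⁻ ω, ‖X ω‖ₑ ^ p ∂μ < ∞ := by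
  have hm : ∀ n, AEMeasurable (Xs n) μ := fun n ↦ (hXs.identDistrib n).aemeasurable_fst
  have hX : AEMeasurable X μ := (hXs.identDistrib 0).aemeasurable_snd
  have hlaw := hXs.indep.map_fun_eq_infinitePi_map₀' hm
  simp_rw [fun n ↦ (hXs.identDistrib n).map_eq] at hlaw
  have : IsProbabilityMeasure (μ.map X) := Measure.isProbabilityMeasure_map hX
  have hae : ∀ᵐ x ∂(Measure.infinitePi fun _ : ℕ ↦ μ.map X), weightedSum p q x < ∞ := by
    rw [← hlaw, ae_map_iff (aemeasurable_pi_iff.2 hm)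
      (measurableSet_lt (measurable_weightedSum p q) measurable_const)]
    exact h
  have := lintegral_enorm_rpow_lt_top hp hq hae
  rwa [lintegral_map' (by fun_prop) hX] at this

end PQStrongLaw

theorem theorem2p1 {Ω B : Type*} [MeasurableSpace Ω] (μ : Measure Ω) [IsProbabilityMeasure μ]
    [NormedAddCommGroup B] [NormedSpace ℝ B] [CompleteSpace B]
    [TopologicalSpace.SeparableSpace B] [MeasurableSpace B] [BorelSpace B]
    (p q : ℝ) (hp0 : 0 < p) (hp1 : p < 1) (hpq : p < q)
    (X : Ω → B) (Xs : ℕ → Ω → B) (hXs : PQStrongLaw.IsIndepCopies μ X Xs) :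
    (PQStrongLaw.SLLN μ p q Xs ↔ ∫⁻ ω, ‖X ω‖ₑ ^ p ∂μ < ∞) ∧
    (∑' n : ℕ, ((n + 1 : ℕ) : ℝ≥0∞)⁻¹ *
        ∫⁻ ω, PQStrongLaw.normalizedPow p q Xs (n + 1) ω ∂μ < ∞ ↔
      ∫⁻ ω, ‖X ω‖ₑ ^ q ∂μ < ∞) := by
  have hq : 0 < q := hp0.trans hpq
  have : SecondCountableTopology B := UniformSpace.secondCountable_of_separable B
  refine ⟨?_, PQStrongLaw.tsum_lintegral_lt_top_iff hp0 hp1 hpq hXs.identDistrib⟩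
  have hiff : PQStrongLaw.SLLN μ p q Xs ↔
      ∀ᵐ ω ∂μ, PQStrongLaw.weightedSum p q (fun k ↦ Xs k ω) < ∞ := by
    simp_rw [PQStrongLaw.SLLN, PQStrongLaw.inv_mul_normalizedPow hq, PQStrongLaw.weightedSum]
  rw [hiff]
  exact ⟨PQStrongLaw.lintegral_enorm_rpow_lt_top_of_ae_weightedSum hp0 hq hXs,
    PQStrongLaw.ae_weightedSum_lt_top hp0 hp1 hpq hXs.identDistrib⟩
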